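/- **Theorem.** Let $n\ge 5$ and $m\ge 2$, and regard the torus $\mathbb{Z}_n^m$ as the graph in which the edges are the pairs $\{x,x+e_i\}$ ($x\in\mathbb{Z}_n^m$, $1\le i\le m$, where $e_i$ is the $i$-th standard generator), oriented from $x$ to $x+e_i$. Let $E$ be its edge set, let $D:\mathbb{R}^E\to\mathbb{R}^{\mathbb{Z}_n^m}$ be the incidence operator $$(DF)(v)=\sum_{e:\ \mathrm{head}(e)=v}F(e)-\sum_{e:\ \mathrm{tail}(e)=v}F(e),$$ and let $Z(\mathbb{Z}_n^m)=\ker D\subseteq\mathbb{R}^E$ be the cycle space. A linear projection $P$ of $\mathbb{R}^E$ onto $Z(\mathbb{Z}_n^m)$ is called *invariant* if $P\theta=\theta P$ for every linear isometry $\theta$ of $\ell_1(E)=(\mathbb{R}^E,\ \|F\|_1=\sum_{e\in E}|F(e)|)$ that maps $Z(\mathbb{Z}_n^m)$ onto itself. Then there exists an invariant projection onto $Z(\mathbb{Z}_n^m)$ which is different from the orthogonal projection (with respect to the standard inner product of $\mathbb{R}^E$) onto $Z(\mathbb{Z}_n^m)$. -/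

import Mathlib

open scoped BigOperators

noncomputable section

/-- A reference orientation of a simple graph `G`, with the edges of `G` indexed by `E`:
`tail e` and `head e` are adjacent, and each edge of `G` is `{tail e, head e}` for exactly
one `e : E`. -/
structure ReferenceOrientation {V : Type*} (G : SimpleGraph V) (E : Type*) where
  tail : E → V
  head : E → V
  adj : ∀ e, G.Adj (tail e) (head e)
  existsUnique : ∀ x y, G.Adj x y → ∃! e, s(tail e, head e) = s(x, y)

namespace ReferenceOrientation

variable {V : Type*} {G : SimpleGraph V} {E : Type*}

open Classical in
/-- The operator `D : ℝ^E → ℝ^V` of the incidence matrix: `(D F) v` is the sum of `F e` over the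
edges `e` with head `v`, minus the sum over the edges with tail `v`. The edge space `ℝ^E` carries
the standard (Euclidean) inner product. -/
def incidence [Fintype E] (o : ReferenceOrientation G E) :
    EuclideanSpace ℝ E →ₗ[ℝ] (V → ℝ) where
  toFun F := fun v =>
    (∑ e : E, if o.head e = v then F e else 0) - ∑ e : E, if o.tail e = v then F e else 0
  map_add' F F' := by
    funext v
    simp only [PiLp.add_apply, Pi.add_apply, ← Finset.sum_sub_distrib, ← Finset.sum_add_distrib]
    refine Finset.sum_congr rfl fun e _ => ?_
    split_ifs <;> ring
  map_smul' c F := by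
    funext v
    simp only [PiLp.smul_apply, Pi.smul_apply, smul_eq_mul, RingHom.id_apply, mul_sub,
      Finset.mul_sum, mul_ite, mul_zero]

/-- The cycle space `Z(G) = ker D`. -/
def cycleSpace [Fintype E] (o : ReferenceOrientation G E) : Submodule ℝ (EuclideanSpace ℝ E) :=
  LinearMap.ker o.incidence

/-- The group of linear isometries of `ℓ₁(E)` for which `Z(G)` is invariant. -/
def cycleIsometryGroup [Fintype E] (o : ReferenceOrientation G E) :
    Subgroup (EuclideanSpace ℝ E ≃ₗ[ℝ] EuclideanSpace ℝ E) where
  carrier := {θ | (∀ F, ∑ e, |θ F e| = ∑ e, |F e|) ∧ ∀ F, θ F ∈ o.cycleSpace ↔ F ∈ o.cycleSpace}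
  mul_mem' := by
    rintro θ η ⟨h1, h2⟩ ⟨k1, k2⟩
    refine ⟨fun F => ?_, fun F => ?_⟩
    · rw [LinearEquiv.mul_apply, h1, k1]
    · rw [LinearEquiv.mul_apply, h2, k2]
  one_mem' := ⟨fun _ => rfl, fun _ => Iff.rfl⟩
  inv_mem' := by
    rintro θ ⟨h1, h2⟩
    refine ⟨fun F => ?_, fun F => ?_⟩
    · rw [← h1 (θ⁻¹ F), ← LinearEquiv.mul_apply, mul_inv_cancel, LinearEquiv.coe_one, id]
    · rw [← h2 (θ⁻¹ F), ← LinearEquiv.mul_apply, mul_inv_cancel, LinearEquiv.coe_one, id]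

/-- By finite-dimensionality, a linear isometry of `ℓ₁(E)` belongs to the group as soon as it
maps `Z(G)` into `Z(G)`. -/
theorem mem_cycleIsometryGroup_iff [Fintype E] (o : ReferenceOrientation G E)
    (θ : EuclideanSpace ℝ E ≃ₗ[ℝ] EuclideanSpace ℝ E) :
    θ ∈ o.cycleIsometryGroup ↔
      (∀ F, ∑ e, |θ F e| = ∑ e, |F e|) ∧ ∀ F ∈ o.cycleSpace, θ F ∈ o.cycleSpace := by
  refine ⟨fun h => ⟨h.1, fun F hF => (h.2 F).2 hF⟩, fun h => ⟨h.1, fun F => ⟨fun hF => ?_, h.2 F⟩⟩⟩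
  have hle : o.cycleSpace.map θ.toLinearMap ≤ o.cycleSpace := by
    rintro _ ⟨F', hF', rfl⟩
    exact h.2 F' hF'
  have heq : o.cycleSpace.map θ.toLinearMap = o.cycleSpace :=
    Submodule.eq_of_le_of_finrank_eq hle (LinearEquiv.finrank_map_eq θ o.cycleSpace)
  rw [← heq] at hF
  obtain ⟨F', hF', hFF'⟩ := hF
  rwa [← θ.injective hFF']

/-- An invariant projection onto `Z(G)`: a linear projection of `ℝ^E` onto `Z(G)` which commutes
with every linear isometry of `ℓ₁(E)` for which `Z(G)` is invariant. -/
def IsInvariantProjection [Fintype E] (o : ReferenceOrientation G E)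
    (P : EuclideanSpace ℝ E →ₗ[ℝ] EuclideanSpace ℝ E) : Prop :=
  LinearMap.IsProj o.cycleSpace P ∧ ∀ θ ∈ o.cycleIsometryGroup, ∀ F, P (θ F) = θ (P F)

/-- The orthogonal projection of `ℓ₂(E)` onto `Z(G)`. -/
def orthProjection [Fintype E] (o : ReferenceOrientation G E) :
    EuclideanSpace ℝ E →ₗ[ℝ] EuclideanSpace ℝ E :=
  (o.cycleSpace.starProjection).toLinearMap

end ReferenceOrientation

/-- The torus `ℤ_n^m`, as the Cayley graph of the group `ℤ_n^m` with respect to the standard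
generators. -/
def torusGraph (n m : ℕ) : SimpleGraph (Fin m → ZMod n) :=
  SimpleGraph.addCayley (Set.range fun i : Fin m => Pi.single i (1 : ZMod n))

/-- The standard orientation of `ℤ_n^m`: the edge with index `(x, i)` goes from `x` to `x + e_i`,
where `e_i` is the `i`-th standard generator. -/
def torusOrientation (n m : ℕ) (hn : 3 ≤ n) :
    ReferenceOrientation (torusGraph n m) ((Fin m → ZMod n) × Fin m) where
  tail e := e.1
  head e := e.1 + Pi.single e.2 1
  adj := by
    rintro ⟨x, i⟩
    have : Fact (1 < n) := ⟨by omega⟩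
    refine (SimpleGraph.addCayley_adj' _ _ _).2 ⟨fun h => ?_, _, ⟨i, rfl⟩, Or.inl rfl⟩
    have := congrFun h i
    simp at this
  existsUnique := by
    have : Fact (1 < n) := ⟨by omega⟩
    have h2 : (1 + 1 : ZMod n) ≠ 0 := fun h => by
      have h' : ((2 : ℕ) : ZMod n) = 0 := by push_cast; rw [← h]; norm_num
      have := Nat.le_of_dvd (by norm_num) ((ZMod.natCast_eq_zero_iff _ _).1 h')
      omega
    have key : ∀ (x : Fin m → ZMod n) (i : Fin m) (e : (Fin m → ZMod n) × Fin m),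
        s(e.1, e.1 + Pi.single e.2 1) = s(x, x + Pi.single i 1) → e = (x, i) := by
      rintro x i ⟨z, j⟩ h
      rcases Sym2.eq_iff.1 h with ⟨h1, h3⟩ | ⟨h1, h3⟩
      · simp only at h1 h3
        subst h1
        have h4 := congrFun (add_left_cancel h3) j
        have : j = i := by
          by_contra hji
          rw [Pi.single_eq_same, Pi.single_eq_of_ne hji] at h4
          exact one_ne_zero h4
        rw [this]
      · exfalso
        simp only at h1 h3
        subst h1
        have h4 := congrFun h3 i
        simp only [Pi.add_apply, Pi.single_eq_same] at h4
        rw [add_assoc, add_eq_left] at h4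
        by_cases hij : i = j
        · subst hij
          rw [Pi.single_eq_same] at h4
          exact h2 h4
        · rw [Pi.single_eq_of_ne hij, add_zero] at h4
          exact one_ne_zero h4
    intro x y hxy
    obtain ⟨-, _, ⟨i, rfl⟩, h | h⟩ := (SimpleGraph.addCayley_adj' _ _ _).1 hxy
    · exact ⟨(x, i), by simp [← h], fun e he => key x i e (by rw [he, ← h])⟩
    · exact ⟨(y, i), by simp [h, Sym2.eq_swap],
        fun e he => key y i e (by rw [he, h, Sym2.eq_swap])⟩

end

/-!
The isometries of `ℓ₁(E)` are the signed permutations of the edges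
(`exists_signed_perm_of_l1_isometry`), hence orthogonal, so the orthogonal projection `P₀` onto the
cycle space `Z` commutes with all those that preserve `Z`. If `N` is any operator commuting with
these isometries, then `P₀ + P₀ N (1 - P₀)` is an invariant projection onto `Z`, and it differs from
`P₀` as soon as `⟨N s, z⟩ ≠ 0` for some `s ⊥ Z` and `z ∈ Z` (`exists_isInvariantProjection_ne`).

For the torus, `N = oppositeSum` is the adjacency operator of the relation "`e` and `f` are opposite
edges of a unit square". Its invariance does not need a description of the isometry group: it is
enough to express this relation in terms of the signed permutation structure and `Z` alone
(`opposite_iff`).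

* For `n ≥ 5` the flow of a vector of `Z` with at most four nonzero coordinates through each layer
  of parallel edges vanishes, since it misses one of the `n` layers. As its support has no vertex of
  degree one, it is the boundary of a unit square. So two distinct edges in a common such support
  are either opposite, with opposite signs, or share a vertex (`opposite_of_short_cycle`).
* Two edges sharing a vertex lie in the support of the star of that vertex, which is orthogonal to
  `Z` and in which each edge lies in a common square with all others but one
  (`starRel_of_incident`). No vector orthogonal to `Z` with the latter property is nonzero on two
  opposite edges: it sums to zero along each of the two lines containing them, so it is nonzero on
  a second edge of each line, and neither of these lies in a square with the first of the opposite
  edges (`Opposite.not_starRel`).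

Finally, `⟨N s, z⟩ = 1` when `s` is the star of the vertex `2 e_j` and `z` is the boundary of the
square spanned at `0` by `e_i` and `e_j` (`sum_oppositeSum_starVector_mul_squareCycle`).
-/

noncomputable section

/-! ### Isometries of `ℓ₁` -/

/-- A linear isometry of the finite-dimensional space `ℓ₁(E)` is a signed permutation of the
coordinates: the images of distinct unit vectors have disjoint supports, because
`|a + b| = |a| + |b| = |a - b|` forces `a * b = 0`, and `|E|` disjoint nonempty subsets of `E` are
singletons. -/
theorem exists_signed_perm_of_l1_isometry {E : Type*} [Fintype E]
    (θ : EuclideanSpace ℝ E ≃ₗ[ℝ] EuclideanSpace ℝ E)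
    (h : ∀ F, ∑ e, |θ F e| = ∑ e, |F e|) :
    ∃ (σ : Equiv.Perm E) (ε : E → ℝ), (∀ e, ε e * ε e = 1) ∧
      ∀ F e, θ F (σ e) = ε e * F e := by
  classical
  set u : E → EuclideanSpace ℝ E := fun e => θ (EuclideanSpace.single e 1) with hu
  have hone : ∀ e, ∑ g, |u e g| = 1 := by
    intro e
    rw [hu, h, Finset.sum_eq_single e]
    · simp
    · intro b _ hb
      simp [hb]
    · simp
  have htwo : ∀ e f, e ≠ f → ∀ c : ℝ, |c| = 1 → ∑ g, |u e g + c * u f g| = 2 := by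
    intro e f hef c hc
    have h1 : ∀ g, u e g + c * u f g
        = θ (EuclideanSpace.single e 1 + c • EuclideanSpace.single f 1) g := by
      intro g
      simp [hu]
    simp only [h1]
    rw [h, Finset.sum_eq_add e f hef]
    · simp [hef, hef.symm, hc]
      norm_num
    · intro g _ hg
      simp [hg.1, hg.2]
    · simp
    · simp
  have hdisj : ∀ e f, e ≠ f → ∀ g, u e g * u f g = 0 := by
    intro e f hef
    have key : ∀ c : ℝ, |c| = 1 → ∀ g, |u e g + c * u f g| = |u e g| + |u f g| := by
      intro c hc
      have hle : ∀ g ∈ Finset.univ, |u e g + c * u f g| ≤ |u e g| + |u f g| := by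
        intro g _
        refine (abs_add_le _ _).trans ?_
        rw [abs_mul, hc, one_mul]
      have hsum : ∑ g, |u e g + c * u f g| = ∑ g, (|u e g| + |u f g|) := by
        rw [htwo e f hef c hc, Finset.sum_add_distrib, hone, hone]
        norm_num
      intro g
      exact (Finset.sum_eq_sum_iff_of_le hle).1 hsum g (Finset.mem_univ g)
    intro g
    have h1 := key 1 (by simp) g
    have h2 := key (-1) (by simp) g
    have h3 := sq_abs (u e g + 1 * u f g)
    have h4 := sq_abs (u e g + -1 * u f g)
    rw [h1] at h3
    rw [h2] at h4
    nlinarith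
  have hex : ∀ e, ∃ g, u e g ≠ 0 := by
    intro e
    by_contra! hc
    have := hone e
    simp [hc] at this
  choose s hs using hex
  have hinj : Function.Injective s := by
    intro e f hef
    by_contra hne
    have := hdisj e f hne (s e)
    rcases mul_eq_zero.1 this with h1 | h1
    · exact hs e h1
    · exact hs f (hef ▸ h1)
  let σ : Equiv.Perm E := Equiv.ofBijective s (Finite.injective_iff_bijective.1 hinj)
  have hzero : ∀ e f, f ≠ e → u f (σ e) = 0 := by
    intro e f hfe
    rcases mul_eq_zero.1 (hdisj e f hfe.symm (σ e)) with h1 | h1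
    · exact absurd h1 (hs e)
    · exact h1
  refine ⟨σ, fun e => u e (σ e), fun e => ?_, fun F e => ?_⟩
  · have h1 : |u e (σ e)| = 1 := by
      rw [← hone e, Finset.sum_eq_single (σ e)]
      · intro g _ hg
        obtain ⟨f, rfl⟩ := σ.surjective g
        rw [hzero f e (fun h => hg (by rw [h])), abs_zero]
      · simp
    rw [← abs_mul_abs_self, h1, one_mul]
  · have hF : F = ∑ f, F f • EuclideanSpace.single f (1 : ℝ) := by
      ext g
      simp [Pi.single_apply]
    have hθ : θ F = ∑ f, F f • u f := by
      conv_lhs => rw [hF]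
      rw [map_sum]
      simp [hu]
    rw [hθ]
    simp only [WithLp.ofLp_sum, WithLp.ofLp_smul, Finset.sum_apply, Pi.smul_apply, smul_eq_mul]
    rw [Finset.sum_eq_single e]
    · ring
    · intro f _ hf
      rw [hzero e f hf, mul_zero]
    · simp

section SignedPerm

variable {E : Type*} {θ : EuclideanSpace ℝ E ≃ₗ[ℝ] EuclideanSpace ℝ E}
  {σ : Equiv.Perm E} {ε : E → ℝ}

theorem signedPerm_inv_apply (hε : ∀ e, ε e * ε e = 1) (hσ : ∀ F e, θ F (σ e) = ε e * F e)
    (F : EuclideanSpace ℝ E) (e : E) : θ⁻¹ F (σ.symm e) = ε (σ.symm e) * F e := by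
  have h := hσ (θ⁻¹ F) (σ.symm e)
  rw [← LinearEquiv.mul_apply, mul_inv_cancel, LinearEquiv.coe_one, id, σ.apply_symm_apply] at h
  rw [h, ← mul_assoc, hε, one_mul]

theorem signedPerm_ne_zero_iff (hε : ∀ e, ε e * ε e = 1) (hσ : ∀ F e, θ F (σ e) = ε e * F e)
    (F : EuclideanSpace ℝ E) (e : E) : θ F (σ e) ≠ 0 ↔ F e ≠ 0 := by
  have : ε e ≠ 0 := fun h => by simpa [h] using hε e
  rw [hσ]
  simp [this]

open Classical in
theorem signedPerm_card_support [Fintype E] (hε : ∀ e, ε e * ε e = 1)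
    (hσ : ∀ F e, θ F (σ e) = ε e * F e)
    (F : EuclideanSpace ℝ E) :
    (Finset.univ.filter fun g => θ F g ≠ 0).card = (Finset.univ.filter fun g => F g ≠ 0).card := by
  symm
  refine Finset.card_equiv σ fun g => ?_
  simp only [Finset.mem_filter, Finset.mem_univ, true_and]
  exact (signedPerm_ne_zero_iff hε hσ F g).symm

theorem signedPerm_sum_mul [Fintype E] (hε : ∀ e, ε e * ε e = 1)
    (hσ : ∀ F e, θ F (σ e) = ε e * F e)
    (F F' : EuclideanSpace ℝ E) : ∑ e, θ F e * θ F' e = ∑ e, F e * F' e := by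
  rw [← Equiv.sum_comp σ]
  refine Finset.sum_congr rfl fun e _ => ?_
  rw [hσ, hσ, mul_mul_mul_comm, hε, one_mul]

end SignedPerm

namespace ReferenceOrientation

variable {V : Type*} {G : SimpleGraph V} {E : Type*} [Fintype E]

/-! ### Relations between edges preserved by the isometry group -/

theorem sum_mul_incidence [Fintype V] (o : ReferenceOrientation G E) (F : EuclideanSpace ℝ E)
    (ψ : V → ℝ) :
    ∑ v, ψ v * o.incidence F v = ∑ e, F e * (ψ (o.head e) - ψ (o.tail e)) := by
  classical
  have h1 : ∀ t : E → V, ∑ v, ψ v * (∑ e, if t e = v then F e else 0) = ∑ e, F e * ψ (t e) := by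
    intro t
    simp only [Finset.mul_sum, mul_ite, mul_zero]
    rw [Finset.sum_comm]
    refine Finset.sum_congr rfl fun e _ => ?_
    simp [mul_comm]
  simp only [incidence, LinearMap.coe_mk, AddHom.coe_mk, mul_sub, Finset.sum_sub_distrib]
  rw [← h1, ← h1]

/-- Gradients are orthogonal to the cycle space. -/
theorem sum_mul_gradient_eq_zero [Fintype V] (o : ReferenceOrientation G E)
    {F : EuclideanSpace ℝ E} (hF : F ∈ o.cycleSpace) (ψ : V → ℝ) :
    ∑ e, F e * (ψ (o.head e) - ψ (o.tail e)) = 0 := by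
  rw [← sum_mul_incidence, LinearMap.mem_ker.1 hF]
  simp

open Classical in
/-- Two edges are related if some cycle-space element with at most four nonzero coordinates is
nonzero on both. -/
def ShortCycleRel (o : ReferenceOrientation G E) (e f : E) : Prop :=
  ∃ z ∈ o.cycleSpace, (Finset.univ.filter fun g => z g ≠ 0).card ≤ 4 ∧ z e ≠ 0 ∧ z f ≠ 0

/-- Two edges lie in the support of a common star-like vector: a vector orthogonal to the cycle
space in whose support each edge is unrelated (in the sense of `ShortCycleRel`) to at most one
edge. In the torus the stars of the vertices have this property: only the two collinear edges of a
star are unrelated. -/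
def StarRel (o : ReferenceOrientation G E) (e f : E) : Prop :=
  ∃ s : EuclideanSpace ℝ E, (∀ z ∈ o.cycleSpace, ∑ g, s g * z g = 0) ∧ s e ≠ 0 ∧ s f ≠ 0 ∧
    ∀ g h h', s g ≠ 0 → s h ≠ 0 → s h' ≠ 0 →
      ¬ o.ShortCycleRel g h → ¬ o.ShortCycleRel g h' → h = h'

section SignedPerm

variable {o : ReferenceOrientation G E} {θ : EuclideanSpace ℝ E ≃ₗ[ℝ] EuclideanSpace ℝ E}
  {σ : Equiv.Perm E} {ε : E → ℝ}

theorem ShortCycleRel.map (hθ : θ ∈ o.cycleIsometryGroup) (hε : ∀ e, ε e * ε e = 1)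
    (hσ : ∀ F e, θ F (σ e) = ε e * F e) {e f : E} (h : o.ShortCycleRel e f) :
    o.ShortCycleRel (σ e) (σ f) := by
  obtain ⟨z, hz, hc, he, hf⟩ := h
  refine ⟨θ z, (hθ.2 z).2 hz, ?_, (signedPerm_ne_zero_iff hε hσ z e).2 he,
    (signedPerm_ne_zero_iff hε hσ z f).2 hf⟩
  rw [signedPerm_card_support hε hσ]
  exact hc

theorem StarRel.map (hθ : θ ∈ o.cycleIsometryGroup) (hε : ∀ e, ε e * ε e = 1)
    (hσ : ∀ F e, θ F (σ e) = ε e * F e) {e f : E} (h : o.StarRel e f) :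
    o.StarRel (σ e) (σ f) := by
  obtain ⟨s, hs, he, hf, hrel⟩ := h
  refine ⟨θ s, fun z hz => ?_, (signedPerm_ne_zero_iff hε hσ s e).2 he,
    (signedPerm_ne_zero_iff hε hσ s f).2 hf, fun g h h' => ?_⟩
  · have h1 : z = θ (θ⁻¹ z) := by
      rw [← LinearEquiv.mul_apply, mul_inv_cancel, LinearEquiv.coe_one, id]
    rw [h1] at hz ⊢
    rw [signedPerm_sum_mul hε hσ]
    exact hs _ ((hθ.2 _).1 hz)
  · obtain ⟨g, rfl⟩ := σ.surjective g
    obtain ⟨h, rfl⟩ := σ.surjective h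
    obtain ⟨h', rfl⟩ := σ.surjective h'
    rw [signedPerm_ne_zero_iff hε hσ, signedPerm_ne_zero_iff hε hσ, signedPerm_ne_zero_iff hε hσ]
    intro h1 h2 h3 h4 h5
    rw [hrel g h h' h1 h2 h3 (fun hr => h4 (hr.map hθ hε hσ)) (fun hr => h5 (hr.map hθ hε hσ))]

theorem shortCycleRel_map_iff (hθ : θ ∈ o.cycleIsometryGroup) (hε : ∀ e, ε e * ε e = 1)
    (hσ : ∀ F e, θ F (σ e) = ε e * F e) {e f : E} :
    o.ShortCycleRel (σ e) (σ f) ↔ o.ShortCycleRel e f := by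
  refine ⟨fun h => ?_, fun h => h.map hθ hε hσ⟩
  have := h.map (σ := σ.symm) (ε := fun e => ε (σ.symm e)) (inv_mem hθ) (fun e => hε _)
    (signedPerm_inv_apply hε hσ)
  simpa using this

theorem starRel_map_iff (hθ : θ ∈ o.cycleIsometryGroup) (hε : ∀ e, ε e * ε e = 1)
    (hσ : ∀ F e, θ F (σ e) = ε e * F e) {e f : E} :
    o.StarRel (σ e) (σ f) ↔ o.StarRel e f := by
  refine ⟨fun h => ?_, fun h => h.map hθ hε hσ⟩
  have := h.map (σ := σ.symm) (ε := fun e => ε (σ.symm e)) (inv_mem hθ) (fun e => hε _)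
    (signedPerm_inv_apply hε hσ)
  simpa using this

end SignedPerm

/-! ### Invariant projections from invariant operators -/

theorem orthProjection_apply_mem (o : ReferenceOrientation G E) (F : EuclideanSpace ℝ E) :
    o.orthProjection F ∈ o.cycleSpace :=
  Submodule.starProjection_apply_mem _ _

theorem orthProjection_of_mem (o : ReferenceOrientation G E) {F : EuclideanSpace ℝ E}
    (hF : F ∈ o.cycleSpace) : o.orthProjection F = F :=
  Submodule.starProjection_eq_self_iff.2 hF

theorem orthProjection_eq_zero (o : ReferenceOrientation G E) {F : EuclideanSpace ℝ E}
    (hF : ∀ z ∈ o.cycleSpace, ∑ e, F e * z e = 0) : o.orthProjection F = 0 := by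
  refine (Submodule.starProjection_apply_eq_zero_iff (K := o.cycleSpace)).2 ?_
  rw [Submodule.mem_orthogonal]
  intro z hz
  simpa [PiLp.inner_apply] using hF z hz

theorem sum_sub_orthProjection_mul (o : ReferenceOrientation G E) (F : EuclideanSpace ℝ E)
    {z : EuclideanSpace ℝ E} (hz : z ∈ o.cycleSpace) :
    ∑ e, (F - o.orthProjection F) e * z e = 0 := by
  have h := (Submodule.mem_orthogonal _ _).1
    (Submodule.sub_starProjection_mem_orthogonal (K := o.cycleSpace) F) z hz
  simpa [PiLp.inner_apply, orthProjection] using h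

theorem orthProjection_comm (o : ReferenceOrientation G E)
    {θ : EuclideanSpace ℝ E ≃ₗ[ℝ] EuclideanSpace ℝ E} (hθ : θ ∈ o.cycleIsometryGroup)
    (F : EuclideanSpace ℝ E) : o.orthProjection (θ F) = θ (o.orthProjection F) := by
  obtain ⟨σ, ε, hε, hσ⟩ := exists_signed_perm_of_l1_isometry θ hθ.1
  have h1 : o.orthProjection (θ (F - o.orthProjection F)) = 0 := by
    refine o.orthProjection_eq_zero fun z hz => ?_
    have h2 : z = θ (θ⁻¹ z) := by
      rw [← LinearEquiv.mul_apply, mul_inv_cancel, LinearEquiv.coe_one, id]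
    rw [h2] at hz ⊢
    rw [signedPerm_sum_mul hε hσ]
    exact o.sum_sub_orthProjection_mul F ((hθ.2 _).1 hz)
  rw [map_sub, map_sub, sub_eq_zero] at h1
  rw [h1]
  exact o.orthProjection_of_mem ((hθ.2 _).2 (o.orthProjection_apply_mem F))

/-- If an operator `N` commutes with the isometry group and does not map the orthogonal complement
of the cycle space into itself, then adding the corresponding off-diagonal block of `N` to the
orthogonal projection produces another invariant projection. -/
theorem exists_isInvariantProjection_ne (o : ReferenceOrientation G E)
    (N : EuclideanSpace ℝ E →ₗ[ℝ] EuclideanSpace ℝ E)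
    (hN : ∀ θ ∈ o.cycleIsometryGroup, ∀ F, N (θ F) = θ (N F))
    {s z : EuclideanSpace ℝ E} (hs : ∀ w ∈ o.cycleSpace, ∑ e, s e * w e = 0)
    (hz : z ∈ o.cycleSpace) (hsz : ∑ e, N s e * z e ≠ 0) :
    ∃ P, o.IsInvariantProjection P ∧ P ≠ o.orthProjection := by
  refine ⟨o.orthProjection + o.orthProjection ∘ₗ N ∘ₗ (LinearMap.id - o.orthProjection),
    ⟨⟨fun F => ?_, fun F hF => ?_⟩, fun θ hθ F => ?_⟩, fun h => hsz ?_⟩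
  · exact add_mem (o.orthProjection_apply_mem _) (o.orthProjection_apply_mem _)
  · simp [o.orthProjection_of_mem hF]
  · simp only [LinearMap.add_apply, LinearMap.comp_apply, LinearMap.sub_apply, LinearMap.id_apply]
    rw [o.orthProjection_comm hθ, ← map_sub, hN θ hθ, o.orthProjection_comm hθ, ← map_add]
  · have h1 := LinearMap.congr_fun h s
    simp only [LinearMap.add_apply, LinearMap.comp_apply, LinearMap.sub_apply, LinearMap.id_apply,
      o.orthProjection_eq_zero hs, zero_add, sub_zero] at h1
    have h2 := o.sum_sub_orthProjection_mul (N s) hz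
    rwa [h1, sub_zero] at h2

end ReferenceOrientation

namespace TorusCycle

open ReferenceOrientation

variable {n m : ℕ}

/-! ### Edges of the torus -/

/-- The vertex `v` is an endpoint of the edge `e`. -/
def Incident (e : (Fin m → ZMod n) × Fin m) (v : Fin m → ZMod n) : Prop :=
  v = e.1 ∨ v = e.1 + Pi.single e.2 1

/-- The edges `e` and `f` are opposite edges of a unit square: they have the same direction `i` and
differ by a translation by `± e_j` with `j ≠ i`. -/
def Opposite (e f : (Fin m → ZMod n) × Fin m) : Prop :=
  e.2 = f.2 ∧ ∃ j, j ≠ e.2 ∧ (f.1 = e.1 + Pi.single j 1 ∨ e.1 = f.1 + Pi.single j 1)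

theorem natCast_ne_zero_of_lt (k : ℕ) (hk : 0 < k) (hkn : k < n) : (k : ZMod n) ≠ 0 := fun h =>
  absurd (Nat.le_of_dvd hk ((ZMod.natCast_eq_zero_iff _ _).1 h)) (by omega)

theorem one_ne_zero' (hn : 3 ≤ n) : (1 : ZMod n) ≠ 0 := by
  simpa using natCast_ne_zero_of_lt (n := n) 1 (by omega) (by omega)

theorem two_ne_zero' (hn : 3 ≤ n) : (2 : ZMod n) ≠ 0 := by
  simpa using natCast_ne_zero_of_lt (n := n) 2 (by omega) (by omega)

theorem add_single_ne (hn : 3 ≤ n) (x : Fin m → ZMod n) (i : Fin m) :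
    x + Pi.single i 1 ≠ x := by
  intro h
  have := congrFun h i
  simp [one_ne_zero' hn] at this

theorem eq_of_incident (hn : 3 ≤ n) {g : (Fin m → ZMod n) × Fin m} {x : Fin m → ZMod n} {i : Fin m}
    (h1 : Incident g x) (h2 : Incident g (x + Pi.single i 1)) : g = (x, i) := by
  have hadj := (torusOrientation n m hn).adj (x, i)
  obtain ⟨e, he, huniq⟩ := (torusOrientation n m hn).existsUnique _ _ hadj
  rw [huniq (x, i) rfl]
  refine huniq g ?_
  change s(g.1, g.1 + Pi.single g.2 1) = s(x, x + Pi.single i 1)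
  rw [Sym2.eq_iff]
  have hne := add_single_ne hn x i
  rcases h1 with h1 | h1 <;> rcases h2 with h2 | h2
  · exact absurd (h2.trans h1.symm) hne
  · exact Or.inl ⟨h1.symm, h2.symm⟩
  · exact Or.inr ⟨h2.symm, h1.symm⟩
  · exact absurd (h2.trans h1.symm) hne

/-- The endpoints of an edge of direction `i` agree except in coordinate `i`, where they differ. -/
theorem Incident.apply_eq_of_ne {g : (Fin m → ZMod n) × Fin m} {v : Fin m → ZMod n}
    (h : Incident g v) {k : Fin m} (hk : k ≠ g.2) : v k = g.1 k := by
  rcases h with h | h <;> simp [h, hk]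

theorem Opposite.not_incident (hn : 3 ≤ n) {e f : (Fin m → ZMod n) × Fin m} (h : Opposite e f)
    (v : Fin m → ZMod n) (he : Incident e v) : ¬ Incident f v := by
  intro hf
  obtain ⟨hi, j, hj, h⟩ := h
  have h1 := he.apply_eq_of_ne hj
  have h2 := hf.apply_eq_of_ne (hi ▸ hj)
  have h3 := one_ne_zero' (n := n) hn
  rcases h with h | h <;> have h4 := congrFun h j
  · simp [← h1, ← h2, h3] at h4
  · simp [← h1, ← h2, h3] at h4

/-- If an edge joins two distinct vertices on the same side of a layer of `i`-edges, then these
vertices are neighbours in a direction other than `i`. -/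
theorem Incident.neighbor (hn : 3 ≤ n) {g : (Fin m → ZMod n) × Fin m} {x y : Fin m → ZMod n}
    {i : Fin m} (hx : Incident g x) (hy : Incident g y) (hxy : y ≠ x) (hi : y i = x i) :
    g.2 ≠ i ∧ (y = x + Pi.single g.2 1 ∨ x = y + Pi.single g.2 1) := by
  have h0 : g.2 ≠ i → (g.2 ≠ i ∧ (y = x + Pi.single g.2 1 ∨ x = y + Pi.single g.2 1)) := by
    intro h
    refine ⟨h, ?_⟩
    rcases hx with hx | hx <;> rcases hy with hy | hy
    · exact absurd (hy.trans hx.symm) hxy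
    · left; rw [hy, hx]
    · right; rw [hy, hx]
    · exact absurd (hy.trans hx.symm) hxy
  apply h0
  rintro rfl
  have h1 := one_ne_zero' (n := n) hn
  rcases hx with hx | hx <;> rcases hy with hy | hy
  · exact hxy (hy.trans hx.symm)
  · simp [hx, hy, h1] at hi
  · simp [hx, hy, h1] at hi
  · exact hxy (hy.trans hx.symm)

/-- No edge joins the two sides of a layer of `i`-edges, except the edges of that layer. -/
theorem Incident.eq_of_layer (hn : 3 ≤ n) {g : (Fin m → ZMod n) × Fin m} {x y : Fin m → ZMod n}
    {i : Fin m} (hx : Incident g x) (hy : Incident g (y + Pi.single i 1)) (hi : y i = x i) :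
    y = x := by
  have h1 := one_ne_zero' (n := n) hn
  have h2 := two_ne_zero' (n := n) hn
  by_cases hg : g.2 = i
  · subst hg
    rcases hx with hx | hx <;> rcases hy with hy | hy
    · have := congrFun (hy.trans hx.symm) g.2
      simp [hi, h1] at this
    · rw [hx]
      exact add_right_cancel hy
    · have := congrFun hx g.2
      rw [← hy] at this
      simp only [Pi.add_apply, Pi.single_eq_same] at this
      rw [hi, add_assoc, left_eq_add, one_add_one_eq_two] at this
      exact absurd this h2
    · have := congrFun (hy.trans hx.symm) g.2
      simp [hi, h1] at this
  · have e1 := hx.apply_eq_of_ne (k := i) (Ne.symm hg)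
    have e2 := hy.apply_eq_of_ne (k := i) (Ne.symm hg)
    rw [← e1] at e2
    simp [hi, h1] at e2

section CycleSpace

/-! ### The cycle space of the torus -/

variable [NeZero n]

theorem incidence_torus_apply (hn : 3 ≤ n)
    (F : EuclideanSpace ℝ ((Fin m → ZMod n) × Fin m)) (v : Fin m → ZMod n) :
    (torusOrientation n m hn).incidence F v
      = ∑ k, F (v - Pi.single k 1, k) - ∑ k, F (v, k) := by
  have h := sum_mul_incidence (torusOrientation n m hn) F (fun w => if w = v then 1 else 0)
  change _ = ∑ e : (Fin m → ZMod n) × Fin m,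
    F e * ((if e.1 + Pi.single e.2 1 = v then 1 else 0) - (if e.1 = v then 1 else 0)) at h
  simp only [ite_mul, one_mul, zero_mul, Finset.sum_ite_eq', Finset.mem_univ, if_true] at h
  rw [h, Fintype.sum_prod_type_right]
  simp only [mul_sub, mul_ite, mul_one, mul_zero, Finset.sum_sub_distrib]
  congr 1
  · refine Finset.sum_congr rfl fun k _ => ?_
    simp [← eq_sub_iff_add_eq]
  · refine Finset.sum_congr rfl fun k _ => ?_
    simp

theorem sum_mul_gradient_torus {hn : 3 ≤ n} {z : EuclideanSpace ℝ ((Fin m → ZMod n) × Fin m)}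
    (hz : z ∈ (torusOrientation n m hn).cycleSpace) (ψ : (Fin m → ZMod n) → ℝ) :
    ∑ e, z e * (ψ (e.1 + Pi.single e.2 1) - ψ e.1) = 0 :=
  sum_mul_gradient_eq_zero _ hz ψ

section ShortCycle

variable {hn : 3 ≤ n} {z : EuclideanSpace ℝ ((Fin m → ZMod n) × Fin m)}

open Classical in
/-- The flow of a cycle-space element through a layer of `i`-edges does not depend on the layer:
two consecutive layers consist of all the edges that leave a hyperplane `x_i = t + 1`. -/
theorem flux_succ (hz : z ∈ (torusOrientation n m hn).cycleSpace) (i : Fin m) (t : ZMod n) :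
    (∑ x, if x i = t + 1 then z (x, i) else 0) = ∑ x, if x i = t then z (x, i) else 0 := by
  have h := sum_mul_gradient_torus hz (fun v => if v i = t + 1 then (1 : ℝ) else 0)
  rw [Fintype.sum_prod_type_right, Finset.sum_eq_single i] at h
  · simp only [Pi.add_apply, Pi.single_eq_same, add_left_inj, mul_sub, mul_ite,
      mul_one, mul_zero, Finset.sum_sub_distrib] at h
    linarith
  · intro k _ hk
    simp [hk.symm]
  · simp

open Classical in
/-- If the support of a cycle-space element is smaller than the number `n` of layers, then it misses
a layer, so that its flow through every layer vanishes. -/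
theorem flux_eq_zero (hz : z ∈ (torusOrientation n m hn).cycleSpace)
    (hc : (Finset.univ.filter fun g => z g ≠ 0).card < n) (i : Fin m) (t : ZMod n) :
    (∑ x, if x i = t then z (x, i) else 0) = 0 := by
  have hconst : ∀ k : ℕ, (∑ x, if x i = (k : ZMod n) then z (x, i) else 0)
      = ∑ x, if x i = 0 then z (x, i) else 0 := by
    intro k
    induction k with
    | zero => simp
    | succ k ih => rw [← ih, Nat.cast_succ, flux_succ hz]
  have hall : ∀ t, (∑ x, if x i = t then z (x, i) else 0)
      = ∑ x, if x i = 0 then z (x, i) else 0 := by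
    intro t
    have := hconst t.val
    rwa [ZMod.natCast_zmod_val] at this
  obtain ⟨t₀, ht₀⟩ : ∃ t₀, t₀ ∉ (Finset.univ.filter fun g => z g ≠ 0).image fun g => g.1 i := by
    by_contra! h
    have h1 := Finset.card_le_card (fun t _ => h t : (Finset.univ : Finset (ZMod n)) ⊆ _)
    rw [Finset.card_univ, ZMod.card] at h1
    have h2 := h1.trans Finset.card_image_le
    omega
  rw [hall t, ← hall t₀]
  refine Finset.sum_eq_zero fun x _ => ?_
  split_ifs with hx
  · by_contra h
    exact ht₀ (Finset.mem_image.2 ⟨(x, i), by simpa using h, hx⟩)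
  · rfl

open Classical in
theorem exists_ne_of_mem_layer (hz : z ∈ (torusOrientation n m hn).cycleSpace)
    (hc : (Finset.univ.filter fun g => z g ≠ 0).card < n) {x : Fin m → ZMod n} {i : Fin m}
    (hx : z (x, i) ≠ 0) : ∃ y, y ≠ x ∧ y i = x i ∧ z (y, i) ≠ 0 := by
  by_contra! h
  have h1 := flux_eq_zero hz hc i (x i)
  rw [Finset.sum_eq_single x] at h1
  · simp [hx] at h1
  · intro y _ hy
    split_ifs with hi
    · exact h y hy hi
    · rfl
  · simp

/-- The support of a cycle-space element has no vertex of degree one. -/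
theorem exists_ne_of_incident (hz : z ∈ (torusOrientation n m hn).cycleSpace)
    {e : (Fin m → ZMod n) × Fin m} (he : z e ≠ 0) {v : Fin m → ZMod n} (hv : Incident e v) :
    ∃ f, f ≠ e ∧ z f ≠ 0 ∧ Incident f v := by
  classical
  by_contra! h
  have h1 := sum_mul_gradient_torus hz (fun w => if w = v then (1 : ℝ) else 0)
  rw [Finset.sum_eq_single e] at h1
  · have hne := add_single_ne hn e.1 e.2
    rcases hv with rfl | rfl
    · simp [hne, he] at h1
    · simp [hne.symm, he] at h1
  · intro f _ hf
    by_cases hzf : z f = 0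
    · simp [hzf]
    · have h2 := h f hf hzf
      simp only [Incident, not_or] at h2
      have h3 : f.1 ≠ v := fun h => h2.1 h.symm
      have h4 : f.1 + Pi.single f.2 1 ≠ v := fun h => h2.2 h.symm
      simp [h3, h4]
  · simp

end ShortCycle

theorem eq_or_of_card_le_four {E : Type*} {S : Finset E} (hS : S.card ≤ 4) {a b c d g : E}
    (ha : a ∈ S) (hb : b ∈ S) (hc : c ∈ S) (hd : d ∈ S) (hg : g ∈ S) (hab : a ≠ b) (hac : a ≠ c)
    (had : a ≠ d) (hbc : b ≠ c) (hbd : b ≠ d) (hcd : c ≠ d) : g = a ∨ g = b ∨ g = c ∨ g = d := by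
  classical
  have h4 : ({a, b, c, d} : Finset E).card = 4 := by
    rw [Finset.card_eq_succ]
    exact ⟨a, {b, c, d}, by simp [hab, hac, had], rfl,
      Finset.card_eq_three.2 ⟨b, c, d, hbc, hbd, hcd, rfl⟩⟩
  have hsub : ({a, b, c, d} : Finset E) ⊆ S := by
    intro x hx
    simp only [Finset.mem_insert, Finset.mem_singleton] at hx
    rcases hx with rfl | rfl | rfl | rfl <;> assumption
  have := Finset.eq_of_subset_of_card_le hsub (by omega)
  rw [← this] at hg
  simpa using hg

open Classical in
/-- A cycle-space element with at most four nonzero coordinates is supported on a unit square: two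
edges of its support without a common endpoint are opposite edges of a unit square, and are
traversed in opposite directions. -/
theorem opposite_of_short_cycle {hn : 3 ≤ n} (hn5 : 5 ≤ n)
    {z : EuclideanSpace ℝ ((Fin m → ZMod n) × Fin m)}
    (hz : z ∈ (torusOrientation n m hn).cycleSpace)
    (hc : (Finset.univ.filter fun g => z g ≠ 0).card ≤ 4) {e f : (Fin m → ZMod n) × Fin m}
    (he : z e ≠ 0) (hf : z f ≠ 0) (hdisj : ∀ v, Incident e v → ¬ Incident f v) :
    Opposite e f ∧ z e * z f < 0 := by
  have hmem : ∀ {g}, z g ≠ 0 → g ∈ Finset.univ.filter fun g => z g ≠ 0 := by simp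
  obtain ⟨x, i⟩ := e
  have hx0 : Incident ((x, i) : (Fin m → ZMod n) × Fin m) x := Or.inl rfl
  have hx1 : Incident ((x, i) : (Fin m → ZMod n) × Fin m) (x + Pi.single i 1) := Or.inr rfl
  have hef : (x, i) ≠ f := by
    rintro rfl
    exact hdisj _ hx0 hx0
  obtain ⟨y, hyx, hyi, hy⟩ := exists_ne_of_mem_layer hz (by omega) he
  have hey : ((x, i) : (Fin m → ZMod n) × Fin m) ≠ (y, i) := by
    intro h
    exact hyx (congrArg Prod.fst h).symm
  obtain ⟨g, hge, hzg, hgx⟩ := exists_ne_of_incident hz he hx0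
  obtain ⟨h, hhe, hzh, hhx⟩ := exists_ne_of_incident hz he hx1
  have hgf : g ≠ f := fun h => hdisj _ hx0 (h ▸ hgx)
  have hhf : h ≠ f := fun h => hdisj _ hx1 (h ▸ hhx)
  have hgh : g ≠ h := by
    rintro rfl
    exact hge (eq_of_incident hn hgx hhx)
  have hgy : g ≠ (y, i) := by
    rintro rfl
    rcases hgx with hgx | hgx
    · exact hyx hgx.symm
    · have := congrFun hgx i
      simp [hyi, one_ne_zero' hn] at this
  have hhy : h ≠ (y, i) := by
    rintro rfl
    rcases hhx with hhx | hhx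
    · have := congrFun hhx i
      simp [hyi, one_ne_zero' hn] at this
    · exact hyx (add_right_cancel hhx).symm
  -- The support consists of `(x, i)`, `f`, `g`, `h`, so `f` is the partner of `(x, i)` in its layer.
  have hfour : ∀ {w}, z w ≠ 0 → w = (x, i) ∨ w = f ∨ w = g ∨ w = h := fun hw =>
    eq_or_of_card_le_four hc (hmem he) (hmem hf) (hmem hzg) (hmem hzh) (hmem hw) hef hge.symm
      hhe.symm hgf.symm hhf.symm hgh
  have hfy : f = (y, i) := by
    rcases hfour hy with h1 | h1 | h1 | h1
    · exact absurd h1.symm hey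
    · exact h1.symm
    · exact absurd h1.symm hgy
    · exact absurd h1.symm hhy
  subst hfy
  have hy0 : Incident ((y, i) : (Fin m → ZMod n) × Fin m) y := Or.inl rfl
  have hy1 : Incident ((y, i) : (Fin m → ZMod n) × Fin m) (y + Pi.single i 1) := Or.inr rfl
  have hgy0 : Incident g y := by
    obtain ⟨w, hwf, hzw, hw⟩ := exists_ne_of_incident hz hf hy0
    rcases hfour hzw with rfl | rfl | rfl | rfl
    · exact absurd hy0 (hdisj _ hw)
    · exact absurd rfl hwf
    · exact hw
    · exact absurd (Incident.eq_of_layer hn hw hhx hyi.symm).symm hyx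
  have hhy1 : Incident h (y + Pi.single i 1) := by
    obtain ⟨w, hwf, hzw, hw⟩ := exists_ne_of_incident hz hf hy1
    rcases hfour hzw with rfl | rfl | rfl | rfl
    · exact absurd hy1 (hdisj _ hw)
    · exact absurd rfl hwf
    · exact absurd (Incident.eq_of_layer hn hgx hw hyi) hyx
    · exact hw
  obtain ⟨hgi, hg⟩ := Incident.neighbor hn hgx hgy0 hyx hyi
  obtain ⟨hhi, -⟩ := Incident.neighbor hn hhx hhy1 (fun h => hyx (add_right_cancel h))
    (i := i) (by simp [hyi])
  refine ⟨⟨rfl, g.2, hgi, hg⟩, ?_⟩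
  have hflux := flux_eq_zero hz (by omega) i (x i)
  rw [Finset.sum_eq_add x y hyx.symm] at hflux
  · simp only [hyi, if_true] at hflux
    have : z (y, i) = -z (x, i) := by linarith
    rw [this]
    have := mul_self_pos.2 he
    linarith
  · rintro w - ⟨hwx, hwy⟩
    split_ifs with hwi
    · by_contra hzw
      rcases hfour hzw with h1 | h1 | h1 | h1
      · exact hwx (congrArg Prod.fst h1)
      · exact hwy (congrArg Prod.fst h1)
      · exact hgi (congrArg Prod.snd h1).symm
      · exact hhi (congrArg Prod.snd h1).symm
    · rfl
  · simp
  · simp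

/-- Distinct edges on a common coordinate line are unrelated. -/
theorem not_shortCycleRel_of_collinear {hn : 3 ≤ n} (hn5 : 5 ≤ n) {x y : Fin m → ZMod n} {i : Fin m}
    (hyx : y ≠ x) (hline : ∀ k, k ≠ i → y k = x k) :
    ¬ (torusOrientation n m hn).ShortCycleRel (x, i) (y, i) := by
  classical
  rintro ⟨z, hz, hc, hx, hy⟩
  have hmem : ∀ {g}, z g ≠ 0 → g ∈ Finset.univ.filter fun g => z g ≠ 0 := by simp
  have hi : y i ≠ x i := by
    intro h
    apply hyx
    funext k
    by_cases hk : k = i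
    · rw [hk, h]
    · exact hline k hk
  obtain ⟨x', hx'x, hx'i, hx'⟩ := exists_ne_of_mem_layer hz (by omega) hx
  obtain ⟨y', hy'y, hy'i, hy'⟩ := exists_ne_of_mem_layer hz (by omega) hy
  have hne : ∀ {a b : Fin m → ZMod n}, a i ≠ b i →
      ((a, i) : (Fin m → ZMod n) × Fin m) ≠ (b, i) := by
    intro a b hab h
    exact hab (congrFun (congrArg Prod.fst h) i)
  have hfour : ∀ {w}, z w ≠ 0 → w = (x, i) ∨ w = (x', i) ∨ w = (y, i) ∨ w = (y', i) := fun hw =>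
    eq_or_of_card_le_four hc (hmem hx) (hmem hx') (hmem hy) (hmem hy') (hmem hw)
      (fun h => hx'x (congrArg Prod.fst h).symm) (hne hi.symm) (hne (by rw [hy'i]; exact hi.symm))
      (hne (by rw [hx'i]; exact hi.symm)) (hne (by rw [hx'i, hy'i]; exact hi.symm))
      (fun h => hy'y (congrArg Prod.fst h).symm)
  have h1 := one_ne_zero' (n := n) hn
  have h2 := two_ne_zero' (n := n) hn
  -- One endpoint of `(x, i)` lies on no other edge of the support: `x` itself, unless the second
  -- layer precedes the first one.
  by_cases hyx1 : y i + 1 = x i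
  · obtain ⟨w, hw, hzw, hwx⟩ := exists_ne_of_incident hz hx (Or.inr rfl)
    have hy2 : x i + 1 ≠ y i := by
      rw [← hyx1, add_assoc, one_add_one_eq_two]
      simp [h2]
    rcases hfour hzw with rfl | rfl | rfl | rfl
    · exact hw rfl
    · rcases hwx with h | h
      · have := congrFun h i
        simp [hx'i, h1] at this
      · exact hx'x (add_right_cancel h).symm
    · rcases hwx with h | h <;> have := congrFun h i
      · simp [hy2] at this
      · simp [hi.symm] at this
    · rcases hwx with h | h <;> have := congrFun h i
      · simp [hy'i, hy2] at this
      · simp [hy'i, hi.symm] at this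
  · obtain ⟨w, hw, hzw, hwx⟩ := exists_ne_of_incident hz hx (Or.inl rfl)
    rcases hfour hzw with rfl | rfl | rfl | rfl
    · exact hw rfl
    · rcases hwx with h | h
      · exact hx'x h.symm
      · have := congrFun h i
        simp [hx'i, h1] at this
    · rcases hwx with h | h <;> have := congrFun h i
      · simp [hi.symm] at this
      · simp [Ne.symm hyx1] at this
    · rcases hwx with h | h <;> have := congrFun h i
      · simp [hy'i, hi.symm] at this
      · simp [hy'i, Ne.symm hyx1] at this

end CycleSpace

/-! ### Squares, lines and stars -/

/-- The boundary of the unit square spanned at `x` by the directions `i` and `j`. -/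
def squareCycle (x : Fin m → ZMod n) (i j : Fin m) : EuclideanSpace ℝ ((Fin m → ZMod n) × Fin m) :=
  EuclideanSpace.single (x, i) 1 + EuclideanSpace.single (x + Pi.single i 1, j) 1
    - EuclideanSpace.single (x + Pi.single j 1, i) 1 - EuclideanSpace.single (x, j) 1

/-- The edges of the unit square spanned at `x` by the directions `i` and `j`. -/
def squareEdges (x : Fin m → ZMod n) (i j : Fin m) : Finset ((Fin m → ZMod n) × Fin m) :=
  {(x, i), (x + Pi.single i 1, j), (x + Pi.single j 1, i), (x, j)}

theorem squareCycle_apply_eq_zero {x : Fin m → ZMod n} {i j : Fin m}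
    {g : (Fin m → ZMod n) × Fin m} (hg : g ∉ squareEdges x i j) : squareCycle x i j g = 0 := by
  simp only [squareEdges, Finset.mem_insert, Finset.mem_singleton, not_or] at hg
  simp [squareCycle, hg.1, hg.2.1, hg.2.2.1, hg.2.2.2]

theorem squareCycle_apply_ne_zero (hn : 3 ≤ n) {x : Fin m → ZMod n} {i j : Fin m} (hij : i ≠ j)
    {g : (Fin m → ZMod n) × Fin m} (hg : g ∈ squareEdges x i j) : squareCycle x i j g ≠ 0 := by
  have : Fact (1 < n) := ⟨by omega⟩
  simp only [squareEdges, Finset.mem_insert, Finset.mem_singleton] at hg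
  rcases hg with rfl | rfl | rfl | rfl <;> simp [squareCycle, hij, hij.symm]

/-- The star of the vertex `v`: the gradient of the indicator function of `v`. -/
def starVector (v : Fin m → ZMod n) : EuclideanSpace ℝ ((Fin m → ZMod n) × Fin m) :=
  WithLp.toLp 2 fun e => (if e.1 + Pi.single e.2 1 = v then 1 else 0) - if e.1 = v then 1 else 0

theorem starVector_ne_zero_iff (hn : 3 ≤ n) (v : Fin m → ZMod n) (e : (Fin m → ZMod n) × Fin m) :
    starVector v e ≠ 0 ↔ Incident e v := by
  have hne := add_single_ne hn e.1 e.2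
  refine ⟨fun h => ?_, fun h => ?_⟩
  · by_contra hv
    simp only [Incident, not_or] at hv
    exact h (by simp [starVector, Ne.symm hv.1, Ne.symm hv.2])
  · rcases h with rfl | rfl
    · simp [starVector, hne]
    · simp [starVector, hne.symm]

variable [NeZero n]

theorem incidence_torus_single (hn : 3 ≤ n) (e : (Fin m → ZMod n) × Fin m) (v : Fin m → ZMod n) :
    (torusOrientation n m hn).incidence (EuclideanSpace.single e 1) v
      = (if e.1 + Pi.single e.2 1 = v then 1 else 0) - if e.1 = v then 1 else 0 := by
  have h := sum_mul_incidence (torusOrientation n m hn) (EuclideanSpace.single e 1)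
    (fun w => if w = v then 1 else 0)
  change _ = ∑ f : (Fin m → ZMod n) × Fin m, (EuclideanSpace.single e (1 : ℝ)) f
    * ((if f.1 + Pi.single f.2 1 = v then 1 else 0) - (if f.1 = v then 1 else 0)) at h
  simp only [ite_mul, one_mul, zero_mul, Finset.sum_ite_eq', Finset.mem_univ, if_true] at h
  rw [h, Finset.sum_eq_single e]
  · simp
  · intro f _ hf
    simp [hf]
  · simp

theorem squareCycle_mem (hn : 3 ≤ n) (x : Fin m → ZMod n) (i j : Fin m) :
    squareCycle x i j ∈ (torusOrientation n m hn).cycleSpace := by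
  refine LinearMap.mem_ker.2 (funext fun v => ?_)
  simp only [squareCycle, map_add, map_sub, Pi.add_apply, Pi.sub_apply, incidence_torus_single,
    add_right_comm x (Pi.single j 1), Pi.zero_apply]
  ring

theorem sum_mul_squareCycle (w : (Fin m → ZMod n) × Fin m → ℝ) (x : Fin m → ZMod n) (i j : Fin m) :
    ∑ e, w e * squareCycle x i j e
      = w (x, i) + w (x + Pi.single i 1, j) - w (x + Pi.single j 1, i) - w (x, j) := by
  have h : ∀ g, ∑ e, w e * (EuclideanSpace.single g (1 : ℝ)) e = w g := by
    intro g
    rw [Finset.sum_eq_single g]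
    · simp
    · intro e _ he
      simp [he]
    · simp
  simp only [squareCycle, PiLp.add_apply, PiLp.sub_apply, mul_add, mul_sub, Finset.sum_add_distrib,
    Finset.sum_sub_distrib, h]

theorem shortCycleRel_of_square (hn : 3 ≤ n) {x : Fin m → ZMod n} {i j : Fin m} (hij : i ≠ j)
    {e f : (Fin m → ZMod n) × Fin m} (he : e ∈ squareEdges x i j) (hf : f ∈ squareEdges x i j) :
    (torusOrientation n m hn).ShortCycleRel e f := by
  classical
  refine ⟨squareCycle x i j, squareCycle_mem hn x i j, ?_, squareCycle_apply_ne_zero hn hij he,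
    squareCycle_apply_ne_zero hn hij hf⟩
  refine (Finset.card_le_card (t := squareEdges x i j) fun g hg => ?_).trans Finset.card_le_four
  by_contra h
  exact (Finset.mem_filter.1 hg).2 (squareCycle_apply_eq_zero h)

theorem shortCycleRel_of_opposite (hn : 3 ≤ n) {e f : (Fin m → ZMod n) × Fin m}
    (h : Opposite e f) : (torusOrientation n m hn).ShortCycleRel e f := by
  obtain ⟨x, i⟩ := e
  obtain ⟨y, i'⟩ := f
  obtain ⟨h1, j, hj, h⟩ := h
  simp only at h1 hj h
  subst h1
  rcases h with rfl | rfl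
  · exact shortCycleRel_of_square hn (x := x) (i := i) (j := j) hj.symm (by simp [squareEdges])
      (by simp [squareEdges])
  · exact shortCycleRel_of_square hn (x := y) (i := i) (j := j) hj.symm (by simp [squareEdges])
      (by simp [squareEdges])

/-- Two perpendicular edges with a common endpoint belong to a unit square. -/
theorem shortCycleRel_of_incident (hn : 3 ≤ n) {e f : (Fin m → ZMod n) × Fin m}
    {v : Fin m → ZMod n} (he : Incident e v) (hf : Incident f v) (hne : e.2 ≠ f.2) :
    (torusOrientation n m hn).ShortCycleRel e f := by
  obtain ⟨x, i⟩ := e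
  obtain ⟨y, j⟩ := f
  simp only [Incident] at he hf hne
  rcases he with he | he <;> rcases hf with hf | hf
  · exact shortCycleRel_of_square hn (x := v) (i := i) (j := j) hne (by simp [squareEdges, he])
      (by simp [squareEdges, hf])
  · exact shortCycleRel_of_square hn (x := y) (i := i) (j := j) hne
      (by simp [squareEdges, ← he, ← hf]) (by simp [squareEdges])
  · exact shortCycleRel_of_square hn (x := x) (i := i) (j := j) hne
      (by simp [squareEdges]) (by simp [squareEdges, ← he, ← hf])
  · have hy : y = x - Pi.single j 1 + Pi.single i 1 := by
      rw [sub_add_eq_add_sub, ← he, hf, add_sub_cancel_right]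
    exact shortCycleRel_of_square hn (x := x - Pi.single j 1) (i := i) (j := j) hne
      (by simp [squareEdges]) (by simp [squareEdges, hy])

/-- The sum of all the edges of the line through `x` of direction `i`. -/
def lineCycle (x : Fin m → ZMod n) (i : Fin m) : EuclideanSpace ℝ ((Fin m → ZMod n) × Fin m) :=
  WithLp.toLp 2 fun e => if e.2 = i ∧ ∀ k, k ≠ i → e.1 k = x k then 1 else 0

theorem lineCycle_mem (hn : 3 ≤ n) (x : Fin m → ZMod n) (i : Fin m) :
    lineCycle x i ∈ (torusOrientation n m hn).cycleSpace := by
  refine LinearMap.mem_ker.2 (funext fun v => ?_)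
  rw [incidence_torus_apply, Pi.zero_apply, sub_eq_zero]
  refine Finset.sum_congr rfl fun k _ => ?_
  have : (k = i ∧ ∀ l, l ≠ i → (v - Pi.single k 1 : Fin m → ZMod n) l = x l)
      ↔ (k = i ∧ ∀ l, l ≠ i → v l = x l) := by
    refine and_congr_right fun hk => forall_congr' fun l => imp_congr_right fun hl => ?_
    rw [Pi.sub_apply, Pi.single_eq_of_ne (by rwa [hk]), sub_zero]
  simp only [lineCycle, this]

theorem exists_ne_of_mem_line {hn : 3 ≤ n} {s : EuclideanSpace ℝ ((Fin m → ZMod n) × Fin m)}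
    (hs : ∀ z ∈ (torusOrientation n m hn).cycleSpace, ∑ e, s e * z e = 0) {x : Fin m → ZMod n}
    {i : Fin m} (hx : s (x, i) ≠ 0) : ∃ y, y ≠ x ∧ (∀ k, k ≠ i → y k = x k) ∧ s (y, i) ≠ 0 := by
  by_contra! h
  have h1 := hs _ (lineCycle_mem hn x i)
  rw [Finset.sum_eq_single (x, i)] at h1
  · simp [lineCycle, hx] at h1
  · rintro ⟨y, l⟩ _ hy
    simp only [lineCycle, mul_ite, mul_one, mul_zero]
    split_ifs with hl
    · obtain ⟨rfl, hl⟩ := hl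
      exact h y (fun hyx => hy (by rw [hyx])) hl
    · rfl
  · simp

theorem sum_starVector_mul {hn : 3 ≤ n} (v : Fin m → ZMod n)
    {z : EuclideanSpace ℝ ((Fin m → ZMod n) × Fin m)}
    (hz : z ∈ (torusOrientation n m hn).cycleSpace) : ∑ e, starVector v e * z e = 0 := by
  rw [← sum_mul_gradient_torus hz fun w => if w = v then 1 else 0]
  exact Finset.sum_congr rfl fun e _ => mul_comm _ _

/-! ### Opposite edges of squares -/

theorem starRel_of_incident (hn : 3 ≤ n) (hm : 2 ≤ m) {e f : (Fin m → ZMod n) × Fin m}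
    {v : Fin m → ZMod n} (he : Incident e v) (hf : Incident f v) :
    (torusOrientation n m hn).StarRel e f := by
  refine ⟨starVector v, fun z hz => sum_starVector_mul v hz, (starVector_ne_zero_iff hn v e).2 he,
    (starVector_ne_zero_iff hn v f).2 hf, ?_⟩
  simp only [starVector_ne_zero_iff hn]
  intro g h h' hg hh hh' hgh hgh'
  have e1 : g.2 = h.2 := by
    by_contra hne
    exact hgh (shortCycleRel_of_incident hn hg hh hne)
  have e2 : g.2 = h'.2 := by
    by_contra hne
    exact hgh' (shortCycleRel_of_incident hn hg hh' hne)
  have : Nontrivial (Fin m) := Fin.nontrivial_iff_two_le.2 hm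
  obtain ⟨j, hj⟩ := exists_ne g.2
  have hgg : (torusOrientation n m hn).ShortCycleRel g g :=
    shortCycleRel_of_square hn (x := g.1) (i := g.2) (j := j) hj.symm (by simp [squareEdges])
      (by simp [squareEdges])
  have n1 : h ≠ g := fun hh => hgh (by rwa [hh])
  have n2 : h' ≠ g := fun hh => hgh' (by rwa [hh])
  -- `v` has only two edges of each direction.
  obtain ⟨a, i⟩ := g
  obtain ⟨b, i'⟩ := h
  obtain ⟨c, i''⟩ := h'
  simp only at e1 e2
  subst e1 e2
  simp only [Incident] at hg hh hh'
  simp only [ne_eq, Prod.mk.injEq, and_true] at n1 n2 ⊢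
  rcases hh with hh | hh <;> rcases hh' with hh' | hh'
  · rw [← hh, ← hh']
  · rcases hg with hg | hg
    · exact absurd (hh.symm.trans hg) n1
    · exact absurd (add_right_cancel (hh'.symm.trans hg)) n2
  · rcases hg with hg | hg
    · exact absurd (hh'.symm.trans hg) n2
    · exact absurd (add_right_cancel (hh.symm.trans hg)) n1
  · exact add_right_cancel (hh.symm.trans hh')

/-- A vector orthogonal to the cycle space whose support contains two opposite edges of a square
also contains a second edge on the line of each of them. Both of these are unrelated to the first of
the opposite edges, so the vector is not star-like. -/
theorem Opposite.not_starRel {hn : 3 ≤ n} (hn5 : 5 ≤ n) {e f : (Fin m → ZMod n) × Fin m}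
    (h : Opposite e f) : ¬ (torusOrientation n m hn).StarRel e f := by
  rintro ⟨s, hs, he, hf, hrel⟩
  obtain ⟨x, i⟩ := e
  obtain ⟨x', i'⟩ := f
  obtain ⟨h1, j, hj, hxx'⟩ := h
  simp only at h1 hj hxx'
  subst h1
  have h3 := one_ne_zero' (n := n) hn
  have hxj : x' j ≠ x j := by
    rcases hxx' with h | h <;> simp [h, h3]
  have hxi : x' i = x i := by
    rcases hxx' with h | h <;> simp [h, hj.symm]
  obtain ⟨y, hyx, hyl, hy⟩ := exists_ne_of_mem_line hs he
  obtain ⟨y', hyx', hyl', hy'⟩ := exists_ne_of_mem_line hs hf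
  have hyj : y' j ≠ x j := by rwa [hyl' j hj]
  have hyi : y' i ≠ x i := by
    intro h
    apply hyx'
    funext k
    by_cases hk : k = i
    · rw [hk, h, hxi]
    · exact hyl' k hk
  have n1 : ¬ (torusOrientation n m hn).ShortCycleRel (x, i) (y, i) :=
    not_shortCycleRel_of_collinear hn5 hyx hyl
  have n2 : ¬ (torusOrientation n m hn).ShortCycleRel (x, i) (y', i) := by
    rintro ⟨z, hz, hc, hze, hzf⟩
    have hopp := (opposite_of_short_cycle hn5 hz hc hze hzf fun v hv hv' => hyj ?_).1
    · obtain ⟨-, k, hk, h⟩ := hopp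
      refine hyi ?_
      rcases h with h | h
      · simpa [hk.symm] using congrFun h i
      · simpa [hk.symm] using (congrFun h i).symm
    · exact (hv'.apply_eq_of_ne hj).symm.trans (hv.apply_eq_of_ne hj)
  have := congrArg Prod.fst (hrel _ _ _ he hy hy' n1 n2)
  simp only at this
  exact hyj (this ▸ hyl j hj)

/-- The relation `Opposite` is expressed by notions preserved by the isometry group. -/
theorem opposite_iff {hn : 3 ≤ n} (hn5 : 5 ≤ n) (hm : 2 ≤ m) {e f : (Fin m → ZMod n) × Fin m} :
    Opposite e f ↔
      (torusOrientation n m hn).ShortCycleRel e f ∧ ¬ (torusOrientation n m hn).StarRel e f := by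
  refine ⟨fun h => ⟨shortCycleRel_of_opposite hn h, h.not_starRel hn5⟩, ?_⟩
  rintro ⟨⟨z, hz, hc, he, hf⟩, hs⟩
  exact (opposite_of_short_cycle hn5 hz hc he hf
    fun v hv hv' => hs (starRel_of_incident hn hm hv hv')).1

/-! ### The invariant operator summing over opposite edges -/

open Classical in
/-- The operator that replaces the value at an edge by the sum of the values at the edges opposite
to it in a unit square. -/
def oppositeSum (n m : ℕ) [NeZero n] : EuclideanSpace ℝ ((Fin m → ZMod n) × Fin m) →ₗ[ℝ]
    EuclideanSpace ℝ ((Fin m → ZMod n) × Fin m) where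
  toFun F := WithLp.toLp 2 fun e => ∑ f, if Opposite e f then F f else 0
  map_add' F F' := by
    ext e
    simp [← Finset.sum_add_distrib, ← ite_add_zero]
  map_smul' c F := by
    ext e
    simp [Finset.mul_sum]

open Classical in
theorem oppositeSum_apply (F : EuclideanSpace ℝ ((Fin m → ZMod n) × Fin m))
    (e : (Fin m → ZMod n) × Fin m) :
    oppositeSum n m F e = ∑ f, if Opposite e f then F f else 0 := rfl

theorem oppositeSum_comm {hn : 3 ≤ n} (hn5 : 5 ≤ n) (hm : 2 ≤ m)
    {θ : EuclideanSpace ℝ ((Fin m → ZMod n) × Fin m) ≃ₗ[ℝ]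
      EuclideanSpace ℝ ((Fin m → ZMod n) × Fin m)}
    (hθ : θ ∈ (torusOrientation n m hn).cycleIsometryGroup)
    (F : EuclideanSpace ℝ ((Fin m → ZMod n) × Fin m)) :
    oppositeSum n m (θ F) = θ (oppositeSum n m F) := by
  obtain ⟨σ, ε, hε, hσ⟩ := exists_signed_perm_of_l1_isometry θ hθ.1
  have hiff : ∀ e f, Opposite (σ e) (σ f) ↔ Opposite e f := by
    intro e f
    rw [opposite_iff (hn := hn) hn5 hm, opposite_iff (hn := hn) hn5 hm,
      shortCycleRel_map_iff hθ hε hσ, starRel_map_iff hθ hε hσ]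
  -- Opposite edges carry the same sign, since a square traverses them in opposite directions both
  -- before and after applying `θ`.
  have hsign : ∀ e f, Opposite e f → ε e = ε f := by
    intro e f h
    obtain ⟨z, hz, hc, he, hf⟩ := shortCycleRel_of_opposite hn h
    have h1 := (opposite_of_short_cycle hn5 hz hc he hf (h.not_incident hn)).2
    have h2 := (opposite_of_short_cycle hn5 ((hθ.2 z).2 hz)
      ((signedPerm_card_support hε hσ z).trans_le hc)
      ((signedPerm_ne_zero_iff hε hσ z e).2 he) ((signedPerm_ne_zero_iff hε hσ z f).2 hf)
      (((hiff e f).2 h).not_incident hn)).2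
    rw [hσ, hσ] at h2
    rcases mul_self_eq_one_iff.1 (hε e) with h3 | h3 <;>
      rcases mul_self_eq_one_iff.1 (hε f) with h4 | h4 <;> rw [h3, h4] at h2 ⊢ <;>
      linarith
  ext g
  obtain ⟨e, rfl⟩ := σ.surjective g
  rw [hσ, oppositeSum_apply, oppositeSum_apply, ← Equiv.sum_comp σ, Finset.mul_sum]
  refine Finset.sum_congr rfl fun f _ => ?_
  by_cases h : Opposite e f
  · rw [if_pos ((hiff e f).2 h), if_pos h, hσ, hsign e f h]
  · rw [if_neg (fun h' => h ((hiff e f).1 h')), if_neg h, mul_zero]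

theorem oppositeSum_starVector_eq_zero (hn : 5 ≤ n) {e : (Fin m → ZMod n) × Fin m}
    {v : Fin m → ZMod n} {j : Fin m} (he : e.1 j = 0) (hv : v j = 2) :
    oppositeSum n m (starVector v) e = 0 := by
  rw [oppositeSum_apply]
  refine Finset.sum_eq_zero fun f _ => ?_
  split_ifs with h
  · by_contra hf
    rw [← ne_eq, starVector_ne_zero_iff (by omega)] at hf
    have h1 := one_ne_zero' (n := n) (by omega)
    have h2 := two_ne_zero' (n := n) (by omega)
    have h3 : (3 : ZMod n) ≠ 0 := by
      simpa using natCast_ne_zero_of_lt (n := n) 3 (by omega) (by omega)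
    obtain ⟨hi, k, hk, h⟩ := h
    by_cases hj : j = f.2
    -- Opposite edges of direction `j` have the same coordinate `j`.
    · have hjk : j ≠ k := by
        rintro rfl
        exact hk (hj.trans hi.symm)
      have h4 : f.1 j = 0 := by
        rcases h with h | h <;> have h5 := congrFun h j
        · simpa [he, hjk] using h5
        · simpa [he, hjk] using h5.symm
      rcases hf with hf | hf <;> have h5 := congrFun hf j
      · rw [hv, h4] at h5
        exact h2 h5
      · rw [hv, Pi.add_apply, h4, ← hj, Pi.single_eq_same, zero_add] at h5
        exact h1 (by linear_combination h5)
    · have h4 := hf.apply_eq_of_ne hj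
      rw [hv] at h4
      rcases h with h | h <;> have h5 := congrFun h j <;>
        rw [Pi.add_apply, he, ← h4, Pi.single_apply] at h5 <;> split_ifs at h5
      · exact h1 (by linear_combination h5)
      · exact h2 (by linear_combination h5)
      · exact h3 (by linear_combination -h5)
      · exact h2 (by linear_combination -h5)
  · rfl

/-- The star of `2 e_j` is moved by `oppositeSum` onto the square spanned at `0` by `e_i` and `e_j`
along the pair of opposite edges `(2 e_j, i)` and `(e_j, i)` only. -/
theorem sum_oppositeSum_starVector_mul_squareCycle (hn : 5 ≤ n) {i j : Fin m} (hij : i ≠ j) :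
    ∑ e, oppositeSum n m (starVector (Pi.single j 2)) e * squareCycle 0 i j e = 1 := by
  have hval : oppositeSum n m (starVector (Pi.single j 2)) (Pi.single j 1, i) = -1 := by
    rw [oppositeSum_apply, Finset.sum_eq_single (Pi.single j 2, i)]
    · rw [if_pos]
      · simp [starVector, add_single_ne (n := n) (by omega)]
      · refine ⟨rfl, j, hij.symm, Or.inl ?_⟩
        rw [← Pi.single_add, one_add_one_eq_two]
    · rintro ⟨c, i'⟩ - hc
      split_ifs with h
      · by_contra hf
        rw [← ne_eq, starVector_ne_zero_iff (by omega)] at hf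
        obtain ⟨hi, k, hk, h⟩ := h
        simp only at hi hk h
        subst hi
        have hci : c i = 0 := by
          rcases h with h | h <;> have h5 := congrFun h i
          · simpa [hij, hk.symm] using h5
          · simpa [hij, hk.symm] using h5.symm
        rcases hf with hf | hf
        · exact hc (by rw [hf])
        · have h5 := congrFun hf i
          simp [hij, hci, (one_ne_zero' (n := n) (by omega)).symm] at h5
      · rfl
    · simp
  rw [sum_mul_squareCycle, zero_add, zero_add, hval,
    oppositeSum_starVector_eq_zero (j := j) hn (by simp) (by simp),
    oppositeSum_starVector_eq_zero (j := j) hn (by simp [hij.symm]) (by simp),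
    oppositeSum_starVector_eq_zero (j := j) hn (by simp) (by simp)]
  norm_num

end TorusCycle

end

/-- For `n ≥ 5` and `m ≥ 2` there is an invariant projection onto the cycle space of the torus
`ℤ_n^m` different from the orthogonal one. -/
theorem mainTheorem9 (n m : ℕ) [NeZero n] (hn : 5 ≤ n) (hm : 2 ≤ m) :
    ∃ P : EuclideanSpace ℝ ((Fin m → ZMod n) × Fin m) →ₗ[ℝ]
        EuclideanSpace ℝ ((Fin m → ZMod n) × Fin m),
      (torusOrientation n m (le_trans (by norm_num) hn)).IsInvariantProjection P ∧
        P ≠ (torusOrientation n m (le_trans (by norm_num) hn)).orthProjection := by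
  have : Nontrivial (Fin m) := Fin.nontrivial_iff_two_le.2 hm
  obtain ⟨i, j, hij⟩ := exists_pair_ne (Fin m)
  refine ReferenceOrientation.exists_isInvariantProjection_ne _ (TorusCycle.oppositeSum n m)
    (fun θ hθ F => TorusCycle.oppositeSum_comm hn hm hθ F)
    (fun z hz => TorusCycle.sum_starVector_mul (Pi.single j 2) hz)
    (TorusCycle.squareCycle_mem _ 0 i j) ?_
  rw [TorusCycle.sum_oppositeSum_starVector_mul_squareCycle hn hij]
  exact one_ne_zero
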